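/- Let $R$ be a commutative $\mathbb{Q}$-algebra and let $U,V$ be abelian groups. Words are finite sequences $w=(w_1,\dots,w_r)$ of letters $w_i=\binom{u_i}{v_i}\in U\times V$, of length $\ell(w)=r$; $\varnothing$ is the empty word and $ab$ is concatenation. For words $a,b,c$, the flexions are defined as follows: ${}_b\lceil c$ is $c$ with the sum of the upper entries $u_i$ of $b$ added to the upper entry of its first letter; $a\rceil_b$ is $a$ with the sum of the upper entries of $b$ added to the upper entry of its last letter; $b\rfloor_c$ is $b$ with the lower entry of the first letter of $c$ subtracted from all its lower entries $v_i$; ${}_a\lfloor b$ is $b$ with the lower entry of the last letter of $a$ subtracted from all its lower entries. (In the last two cases nothing is subtracted if $c$, respectively $a$, is empty; flexions of an empty word are empty.) Let $\mathfrak V$ be a set of words that contains $\varnothing$ and is stable under permutation of letters, under taking factors, and under the four flexions, in the sense that $abc\in\mathfrak V$ implies $a({}_b\lceil c),\ (a\rceil_b)c\in\mathfrak V$ and $ab\in\mathfrak V$ implies ${}_a\lfloor b,\ a\rfloor_b\in\mathfrak V$. (For instance, all words; or, to treat rational functions of the variables, the words whose upper entries are linearly independent linear forms and whose lower entries are too.)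 A bimould is a function $A\colon\mathfrak V\to R$. Write $A\in\mathsf{MU}$ if $A(\varnothing)=1$ and $A\in\mathsf{LU}$ if $A(\varnothing)=0$. For bimoulds $A,B$ and $w\in\mathfrak V$ put $$\mathsf{der}(A)(w)=\ell(w)A(w),\qquad \mathsf{mu}(A,B)(w)=\sum_{w=ab}A(a)B(b),$$ $$\mathsf{arit}(B)(A)(w)=\sum_{\substack{w=abc\\ b,c\ne\varnothing}}A\bigl(a({}_b\lceil c)\bigr)B(b\rfloor_c)-\sum_{\substack{w=abc\\ a,b\ne\varnothing}}A\bigl((a\rceil_b)c\bigr)B({}_a\lfloor b),$$ $$\mathsf{preari}(A,B)=\mathsf{arit}(B)(A)+\mathsf{mu}(A,B).$$ For words $a,b$ with $ab\in\mathfrak V$, let $A(a \mathbin{\mathrm{sh}} b)$ denote the sum of the values of $A$ at all terms, with multiplicity, of the shuffle product of $a$ and $b$. A bimould $D$ is alternal if $D(\varnothing)=0$ and $D(a \mathbin{\mathrm{sh}} b)=0$ for all non-empty $a,b$ with $ab\in\mathfrak V$; a bimould $S$ is symmetral if $S(\varnothing)=1$ and $S(a \mathbin{\mathrm{sh}} b)=S(a)S(b)$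 for all non-empty $a,b$ with $ab\in\mathfrak V$. Let $S\in\mathsf{MU}$ and $D\in\mathsf{LU}$ satisfy $\mathsf{der}(S)=\mathsf{preari}(S,D)$. Then $D$ is alternal if and only if $S$ is symmetral. -/

import Mathlib

namespace Mould

/-- Words `w = (w₁, …, w_r)` whose letters are the two-storey symbols `w_i = (u_i ; v_i)`. -/
abbrev Word (U V : Type*) : Type _ := List (U × V)

section Flexions

variable {U V : Type*} [AddCommGroup U] [AddCommGroup V]

/-- The sum of the upper entries `u_1 + ⋯ + u_r` of a word. -/
def upperSum (w : Word U V) : U := (w.map Prod.fst).sum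

/-- The upper-left flexion `_b⌈c`: the sum of the upper entries of `b` is added to the upper entry
of the first letter of `c`. -/
def ful (b : Word U V) : Word U V → Word U V
  | [] => []
  | x :: c => (upperSum b + x.1, x.2) :: c

/-- The upper-right flexion `a⌉_b`: the sum of the upper entries of `b` is added to the upper entry
of the last letter of `a`. -/
def fur : Word U V → Word U V → Word U V
  | [], _ => []
  | [x], b => [(x.1 + upperSum b, x.2)]
  | x :: y :: a, b => x :: fur (y :: a) b

/-- Subtract `v` from every lower entry of a word. -/
def lowerShift (v : V) (w : Word U V) : Word U V := w.map fun x => (x.1, x.2 - v)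

/-- The lower-left flexion `_a⌊b`: the lower entry of the last letter of `a` is subtracted from
every lower entry of `b`. (Nothing is subtracted if `a` is empty.) -/
def fll (a b : Word U V) : Word U V :=
  match a.getLast? with
  | none => b
  | some x => lowerShift x.2 b

/-- The lower-right flexion `b⌋_c`: the lower entry of the first letter of `c` is subtracted from
every lower entry of `b`. (Nothing is subtracted if `c` is empty.) -/
def flr (b c : Word U V) : Word U V :=
  match c.head? with
  | none => b
  | some x => lowerShift x.2 b

end Flexions

section Words

variable {α : Type*}

/-- All factorizations `w = ab`, as pairs `(a, b)`. -/
def splits : List α → List (List α × List α)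
  | [] => [([], [])]
  | x :: w => ([], x :: w) :: (splits w).map fun p => (x :: p.1, p.2)

/-- All factorizations `w = abc`, as triples `(a, b, c)`. -/
def splits₃ (w : List α) : List (List α × List α × List α) :=
  (splits w).flatMap fun p => (splits p.2).map fun q => (p.1, q.1, q.2)

/-- The terms (with multiplicity) of the shuffle product `a ⧢ b`, which is defined by
`∅ ⧢ b = b`, `a ⧢ ∅ = a` and `xa ⧢ yb = x(a ⧢ yb) + y(xa ⧢ b)`. -/
def shuffle : List α → List α → List (List α)
  | [], b => [b]
  | x :: a, [] => [x :: a]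
  | x :: a, y :: b =>
      (shuffle a (y :: b)).map (x :: ·) ++ (shuffle (x :: a) b).map (y :: ·)
termination_by a b => a.length + b.length

end Words

/-- A domain on which bimoulds are defined: a set of words with letters in `U × V` that is stable
under taking factors, under permutations of the letters and under the four flexions.

With all words one gets bimoulds that are arbitrary functions of `(u₁, …, u_r ; v₁, …, v_r)`.
With the words whose upper entries are linearly independent linear forms (and likewise the lower
ones, or with arbitrary lower entries in a group) one gets the evaluations of bimoulds whose
components are, say, rational functions of the variables. -/
structure Deck (U V : Type*) [AddCommGroup U] [AddCommGroup V] where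
  words : Set (Word U V)
  nil_mem : [] ∈ words
  perm_mem : ∀ {w w' : Word U V}, w.Perm w' → w ∈ words → w' ∈ words
  factor_mem : ∀ {a b : Word U V}, a ++ b ∈ words → a ∈ words
  ful_mem : ∀ {a b c : Word U V}, a ++ b ++ c ∈ words → a ++ ful b c ∈ words
  fur_mem : ∀ {a b c : Word U V}, a ++ b ++ c ∈ words → fur a b ++ c ∈ words
  fll_mem : ∀ {a b : Word U V}, a ++ b ∈ words → fll a b ∈ words
  flr_mem : ∀ {b c : Word U V}, b ++ c ∈ words → flr b c ∈ words

variable {U V : Type*} [AddCommGroup U] [AddCommGroup V]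

/-- The set `BIMU` of bimoulds on the deck `𝒳` with values in `R`. -/
def Bimould (𝒳 : Deck U V) (R : Type*) : Type _ := 𝒳.words → R

namespace Bimould

variable {𝒳 : Deck U V} {R : Type*} [CommRing R]

open Classical in
/-- The value `A(w)`. (The value `0` off the deck is never used: the definitions below only
evaluate bimoulds at words of the deck.) -/
noncomputable def eval (A : Bimould 𝒳 R) (w : Word U V) : R :=
  if h : w ∈ 𝒳.words then A ⟨w, h⟩ else 0

/-- The value of `A`, extended linearly to formal sums of words, at `a ⧢ b`. -/
noncomputable def evalShuffle (A : Bimould 𝒳 R) (a b : Word U V) : R :=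
  ((shuffle a b).map A.eval).sum

/-- `MU`, the bimoulds with value `1` at the empty word. -/
def MU (𝒳 : Deck U V) (R : Type*) [CommRing R] : Set (Bimould 𝒳 R) := {A | A.eval [] = 1}

/-- `LU`, the bimoulds with value `0` at the empty word. -/
def LU (𝒳 : Deck U V) (R : Type*) [CommRing R] : Set (Bimould 𝒳 R) := {A | A.eval [] = 0}

/-- `mu(A, B)(w) = ∑_{w = ab} A(a) B(b)`. -/
noncomputable def mu (A B : Bimould 𝒳 R) : Bimould 𝒳 R := fun w =>
  ((splits w.1).map fun p => A.eval p.1 * B.eval p.2).sum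

/-- `amit(B)(A)(w) = ∑_{w = abc, b ≠ ∅, c ≠ ∅} A(a _b⌈c) B(b⌋_c)`. -/
noncomputable def amit (B A : Bimould 𝒳 R) : Bimould 𝒳 R := fun w =>
  (((splits₃ w.1).filter fun (_, b, c) => !b.isEmpty && !c.isEmpty).map fun (a, b, c) =>
    A.eval (a ++ ful b c) * B.eval (flr b c)).sum

/-- `anit(B)(A)(w) = ∑_{w = abc, a ≠ ∅, b ≠ ∅} A(a⌉_b c) B(_a⌊b)`. -/
noncomputable def anit (B A : Bimould 𝒳 R) : Bimould 𝒳 R := fun w =>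
  (((splits₃ w.1).filter fun (a, b, _) => !a.isEmpty && !b.isEmpty).map fun (a, b, c) =>
    A.eval (fur a b ++ c) * B.eval (fll a b)).sum

/-- `arit(B)(A) = amit(B)(A) - anit(B)(A)`. -/
noncomputable def arit (B A : Bimould 𝒳 R) : Bimould 𝒳 R := fun w =>
  amit B A w - anit B A w

/-- `preari(A, B) = arit(B)(A) + mu(A, B)`. -/
noncomputable def preari (A B : Bimould 𝒳 R) : Bimould 𝒳 R := fun w =>
  arit B A w + mu A B w

/-- `der(A)(w) = ℓ(w) A(w)`, where `ℓ(w)` is the length of `w`. -/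
def der (A : Bimould 𝒳 R) : Bimould 𝒳 R := fun w => (w.1.length : R) * A w

/-- `A` is alternal: `A(∅) = 0` and `A(a ⧢ b) = 0` for all non-empty `a`, `b`. -/
def IsAlternal (A : Bimould 𝒳 R) : Prop :=
  A ∈ LU 𝒳 R ∧ ∀ a b : Word U V, a ≠ [] → b ≠ [] → a ++ b ∈ 𝒳.words → A.evalShuffle a b = 0

/-- `A` is symmetral: `A(∅) = 1` and `A(a ⧢ b) = A(a) A(b)` for all non-empty `a`, `b`. -/
def IsSymmetral (A : Bimould 𝒳 R) : Prop :=
  A ∈ MU 𝒳 R ∧ ∀ a b : Word U V, a ≠ [] → b ≠ [] → a ++ b ∈ 𝒳.words →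
    A.evalShuffle a b = A.eval a * A.eval b

end Bimould

end Mould

/-!
For words `a`, `b` of total length `r`, the relation `der(S) = preari(S, D)`, summed over the terms
of `a ⧢ b`, turns into
`r (S(a ⧢ b) - S(a) S(b)) = D(a ⧢ b)`,
as soon as `S` is symmetral and `D` is alternal on words of length less than `r`
(`Mould.Bimould.length_mul_evalShuffle_sub`). Since `r` is invertible in a `ℚ`-algebra, either
property passes from one bimould to the other by induction on the length.

The identity expresses that `preari(·, D)` acts on a symmetral `S` as a derivation for shuffles,
apart from the term `D(a ⧢ b)` in which `D` takes a word of full length. For `mu(S, D)` this holds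
because deconcatenation is a morphism for the shuffle product, and `D` vanishes at all non-trivial
shuffles (`lsum_muSum`). For `arit(D)(S)` both kinds of summands describe a letter `x` of `w` that
absorbs an adjacent word `q`: the upper sum of `q` is added to `x`, `q` is removed, and `D` is taken
at `q` with the lower entry of `x` subtracted. The two kinds differ only in the side of `x` on which
`q` stands and in the sign. In a shuffle of `a` and `b`, where `x` comes from `a`, say, alternality
of `D` leaves only the words `q` that come entirely from `a` or entirely from `b`. Those from `a`
sum to `arit(D)(S)(a) S(b)`, by symmetrality of `S`. A word `q` from `b` can stand to the left or to
the right of `x`, with the same contribution up to sign, so these terms cancel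
(`lsum_shuffle_cut`, `lsum_aritSum`).
-/

namespace Mould

/-! ### Sums over lists -/

section ListSums

variable {ι κ M : Type*} [AddCommMonoid M]

/-- The sum `∑_{i ∈ l} f i` over the entries of a list, with multiplicity. -/
def lsum (l : List ι) (f : ι → M) : M := (l.map f).sum

@[simp] lemma lsum_nil (f : ι → M) : lsum [] f = 0 := rfl

@[simp] lemma lsum_cons (i : ι) (l : List ι) (f : ι → M) :
    lsum (i :: l) f = f i + lsum l f := by simp [lsum]

@[simp] lemma lsum_append (l l' : List ι) (f : ι → M) :
    lsum (l ++ l') f = lsum l f + lsum l' f := by simp [lsum]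

@[simp] lemma lsum_map (l : List κ) (e : κ → ι) (f : ι → M) :
    lsum (l.map e) f = lsum l fun k => f (e k) := by simp [lsum, Function.comp_def]

lemma lsum_flatMap (l : List κ) (e : κ → List ι) (f : ι → M) :
    lsum (l.flatMap e) f = lsum l fun k => lsum (e k) f := by
  induction l with
  | nil => rfl
  | cons k l ih => simp [ih]

lemma lsum_filter (l : List ι) (P : ι → Bool) (f : ι → M) :
    lsum (l.filter P) f = lsum l fun i => if P i then f i else 0 := by
  induction l with
  | nil => rfl
  | cons i l ih => by_cases h : P i <;> simp [h, ih]

lemma lsum_congr {l : List ι} {f g : ι → M} (h : ∀ i ∈ l, f i = g i) : lsum l f = lsum l g := by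
  rw [lsum, lsum, List.map_congr_left h]

lemma lsum_perm {l l' : List ι} (h : l.Perm l') (f : ι → M) : lsum l f = lsum l' f :=
  (h.map f).sum_eq

lemma lsum_add (l : List ι) (f g : ι → M) :
    lsum l (fun i => f i + g i) = lsum l f + lsum l g := by
  simp [lsum, List.sum_map_add]

@[simp] lemma lsum_zero (l : List ι) : lsum l (fun _ => (0 : M)) = 0 := by
  simp [lsum]

lemma lsum_comm (l : List ι) (l' : List κ) (f : ι → κ → M) :
    lsum l (fun i => lsum l' fun k => f i k) = lsum l' fun k => lsum l fun i => f i k := by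
  induction l with
  | nil => simp
  | cons i l ih => simp [ih, lsum_add]

lemma lsum_sub {G : Type*} [AddCommGroup G] (l : List ι) (f g : ι → G) :
    lsum l (fun i => f i - g i) = lsum l f - lsum l g := by
  induction l with
  | nil => simp
  | cons i l ih => simp only [lsum_cons, ih]; abel

lemma lsum_mul {A : Type*} [NonUnitalNonAssocSemiring A] (l : List ι) (f : ι → A) (c : A) :
    lsum l (fun i => f i * c) = lsum l f * c := by
  simp [lsum, List.sum_map_mul_right]

end ListSums

/-! ### Factorizations and shuffles -/

section Combinatorics

variable {α M : Type*} [AddCommMonoid M]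

/-- All factorizations `w = p x q` with a marked letter `x`, as triples `(p, x, q)`. -/
def pointedSplits : List α → List (List α × α × List α)
  | [] => []
  | x :: w => ([], x, w) :: (pointedSplits w).map fun p => (x :: p.1, p.2)

@[simp] lemma shuffle_nil_left (b : List α) : shuffle [] b = [b] := by
  rw [shuffle.eq_def]

@[simp] lemma shuffle_nil_right (a : List α) : shuffle a [] = [a] := by
  cases a <;> simp [shuffle]

lemma shuffle_cons_cons (x y : α) (a b : List α) :
    shuffle (x :: a) (y :: b) =
      (shuffle a (y :: b)).map (x :: ·) ++ (shuffle (x :: a) b).map (y :: ·) := by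
  rw [shuffle]

lemma append_of_mem_splits {w : List α} {p : List α × List α} (h : p ∈ splits w) :
    p.1 ++ p.2 = w := by
  induction w generalizing p with
  | nil => simp [splits] at h; simp [h]
  | cons x w ih =>
    simp only [splits, List.mem_cons, List.mem_map] at h
    rcases h with rfl | ⟨q, hq, rfl⟩
    · rfl
    · simp [ih hq]

lemma append_of_mem_pointedSplits {w : List α} {p : List α × α × List α}
    (h : p ∈ pointedSplits w) : p.1 ++ p.2.1 :: p.2.2 = w := by
  induction w generalizing p with
  | nil => simp [pointedSplits] at h
  | cons x w ih =>
    simp only [pointedSplits, List.mem_cons, List.mem_map] at h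
    rcases h with rfl | ⟨q, hq, rfl⟩
    · rfl
    · simp [ih hq]

/-- Every shuffle has the same letters as the concatenation. -/
lemma perm_of_mem_shuffle {a b w : List α} (h : w ∈ shuffle a b) : w.Perm (a ++ b) := by
  fun_induction shuffle a b generalizing w with
  | case1 b => simp at h; simp [h]
  | case2 x a => simp at h; simp [h]
  | case3 x a y b ih₁ ih₂ =>
    simp only [List.mem_append, List.mem_map] at h
    rcases h with ⟨v, hv, rfl⟩ | ⟨v, hv, rfl⟩
    · exact (ih₁ hv).cons x
    · exact ((ih₂ hv).cons y).trans List.perm_middle.symm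

lemma shuffle_comm (a b : List α) : (shuffle a b).Perm (shuffle b a) := by
  fun_induction shuffle a b with
  | case1 b => simp
  | case2 x a => simp
  | case3 x a y b ih₁ ih₂ =>
    rw [shuffle_cons_cons]
    exact ((ih₁.map _).append (ih₂.map _)).trans List.perm_append_comm

lemma shuffle_map {β : Type*} (f : α → β) (a b : List α) :
    shuffle (a.map f) (b.map f) = (shuffle a b).map (List.map f) := by
  fun_induction shuffle a b with
  | case1 b => simp
  | case2 x a => simp
  | case3 x a y b ih₁ ih₂ =>
    simp only [List.map_cons] at ih₁ ih₂
    simp [shuffle_cons_cons, ih₁, ih₂, Function.comp_def]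

@[simp] lemma lsum_splits_nil (g : List α × List α → M) : lsum (splits []) g = g ([], []) := by
  simp [splits]

@[simp] lemma lsum_splits_cons (x : α) (w : List α) (g : List α × List α → M) :
    lsum (splits (x :: w)) g = g ([], x :: w) + lsum (splits w) fun p => g (x :: p.1, p.2) := by
  simp [splits]

@[simp] lemma lsum_pointedSplits_nil (g : List α × α × List α → M) :
    lsum (pointedSplits []) g = 0 := rfl

@[simp] lemma lsum_pointedSplits_cons (x : α) (w : List α) (g : List α × α × List α → M) :
    lsum (pointedSplits (x :: w)) g =
      g ([], x, w) + lsum (pointedSplits w) fun p => g (x :: p.1, p.2) := by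
  simp [pointedSplits]

@[simp] lemma lsum_shuffle_cons_cons (x y : α) (a b : List α) (f : List α → M) :
    lsum (shuffle (x :: a) (y :: b)) f =
      (lsum (shuffle a (y :: b)) fun w => f (x :: w)) +
        lsum (shuffle (x :: a) b) fun w => f (y :: w) := by
  simp [shuffle_cons_cons]

/-- A factorization `w = pq` either has `q` empty, or marks the first letter of `q`. -/
lemma lsum_splits_eq_add_right (w : List α) (g : List α → List α → M) :
    lsum (splits w) (fun p => g p.1 p.2) =
      g w [] + lsum (pointedSplits w) fun p => g p.1 (p.2.1 :: p.2.2) := by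
  induction w generalizing g with
  | nil => simp
  | cons x w ih => simp [ih fun p q => g (x :: p) q, add_left_comm]

/-- A factorization `w = pq` either has `p` empty, or marks the last letter of `p`. -/
lemma lsum_splits_eq_add_left (w : List α) (g : List α → List α → M) :
    lsum (splits w) (fun p => g p.1 p.2) =
      g [] w + lsum (pointedSplits w) fun p => g (p.1 ++ [p.2.1]) p.2.2 := by
  induction w generalizing g with
  | nil => simp
  | cons x w ih => simp [ih fun p q => g (x :: p) q]

lemma lsum_splits_ite_right (w : List α) (g : List α → List α → M) :
    lsum (splits w) (fun p => if p.2 = [] then g p.1 p.2 else 0) = g w [] := by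
  rw [lsum_splits_eq_add_right w fun p q => if q = [] then g p q else 0]
  simp

lemma lsum_splits_ite_left (w : List α) (g : List α → List α → M) :
    lsum (splits w) (fun p => if p.1 = [] then g p.1 p.2 else 0) = g [] w := by
  rw [lsum_splits_eq_add_left w fun p q => if p = [] then g p q else 0]
  simp

/-- Coassociativity of deconcatenation. -/
lemma lsum_splits_assoc (w : List α) (g : List α → List α → List α → M) :
    lsum (splits w) (fun p => lsum (splits p.1) fun q => g q.1 q.2 p.2) =
      lsum (splits w) fun p => lsum (splits p.2) fun q => g p.1 q.1 q.2 := by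
  induction w generalizing g with
  | nil => simp
  | cons x w ih => simp [lsum_add, ih fun p q r => g (x :: p) q r, add_assoc]

/-- Coassociativity of deconcatenation with a marked letter in the last factor. -/
lemma lsum_splits_pointedSplits (w : List α) (g : List α → List α → α → List α → M) :
    lsum (splits w) (fun p => lsum (pointedSplits p.2) fun q => g p.1 q.1 q.2.1 q.2.2) =
      lsum (pointedSplits w) fun p => lsum (splits p.1) fun q => g q.1 q.2 p.2.1 p.2.2 := by
  induction w generalizing g with
  | nil => simp
  | cons x w ih => simp [lsum_add, ih fun p q y r => g (x :: p) q y r, add_assoc]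

/-- Deconcatenation is a morphism for the shuffle product. -/
lemma lsum_shuffle_splits (a b : List α) (g : List α → List α → M) :
    lsum (shuffle a b) (fun w => lsum (splits w) fun p => g p.1 p.2) =
      lsum (splits a) fun p => lsum (splits b) fun q =>
        lsum (shuffle p.1 q.1) fun u => lsum (shuffle p.2 q.2) fun v => g u v := by
  fun_induction shuffle a b generalizing g with
  | case1 b => simp
  | case2 x a => simp
  | case3 x a y b ih₁ ih₂ =>
    have h₁ := ih₁ fun u v => g (x :: u) v
    have h₂ := ih₂ fun u v => g (y :: u) v
    simp only [← shuffle_cons_cons] at *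
    simp only [lsum_shuffle_cons_cons, lsum_splits_cons, lsum_add, h₁, h₂, shuffle_nil_left,
      shuffle_nil_right, lsum_cons, lsum_nil, add_zero]
    abel

/-- Marking a letter in a shuffle of `a` and `b` amounts to marking a letter of `a` or of `b` and
cutting the other word. -/
lemma lsum_shuffle_pointedSplits (a b : List α) (g : List α → α → List α → M) :
    lsum (shuffle a b) (fun w => lsum (pointedSplits w) fun p => g p.1 p.2.1 p.2.2) =
      (lsum (pointedSplits a) fun p => lsum (splits b) fun q =>
        lsum (shuffle p.1 q.1) fun u => lsum (shuffle p.2.2 q.2) fun v => g u p.2.1 v) +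
      lsum (pointedSplits b) fun p => lsum (splits a) fun q =>
        lsum (shuffle p.1 q.1) fun u => lsum (shuffle p.2.2 q.2) fun v => g u p.2.1 v := by
  fun_induction shuffle a b generalizing g with
  | case1 b => simp
  | case2 x a => simp
  | case3 x a y b ih₁ ih₂ =>
    have h₁ := ih₁ fun u z v => g (x :: u) z v
    have h₂ := ih₂ fun u z v => g (y :: u) z v
    simp only [← shuffle_cons_cons] at *
    simp only [lsum_shuffle_cons_cons, lsum_splits_cons, lsum_pointedSplits_cons, lsum_add, h₁, h₂,
      shuffle_nil_left, shuffle_nil_right, lsum_cons, lsum_nil, add_zero,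
      fun c => lsum_perm (M := M) (shuffle_comm b (x :: c))]
    abel

/-- A shuffle of `a₁ x a₂` and `b` is cut by the letter `x` into shuffles of `a₁` and `a₂` with the
two parts of a factorization of `b`. -/
lemma lsum_shuffle_append_cons (a₁ : List α) (x : α) (a₂ b : List α) (f : List α → M) :
    lsum (shuffle (a₁ ++ x :: a₂) b) f =
      lsum (splits b) fun q => lsum (shuffle a₁ q.1) fun u => lsum (shuffle a₂ q.2) fun v =>
        f (u ++ x :: v) := by
  induction a₁ generalizing b f with
  | nil =>
    induction b generalizing f with
    | nil => simp
    | cons y b ih =>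
      have h := ih fun w => f (y :: w)
      simp only [List.nil_append, shuffle_nil_left, lsum_cons, lsum_nil, add_zero] at h
      simp [h]
  | cons z a₁ iha =>
    induction b generalizing f with
    | nil => simp
    | cons y b ih =>
      have h₁ := iha (y :: b) fun w => f (z :: w)
      have h₂ := ih fun w => f (y :: w)
      simp only [List.cons_append] at h₁ h₂
      simp only [List.cons_append, lsum_shuffle_cons_cons, h₁, h₂, lsum_splits_cons, lsum_add,
        shuffle_nil_right, lsum_cons, lsum_nil, add_zero]
      abel

end Combinatorics

/-! ### Cutting words out of shuffles -/

section Combinatorics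

variable {α M : Type*}

/-- If, whenever letters of `a` and `b` are distributed over `p`, `q₁` and `q₂`, the function
`g p` sees only the trivial terms of `q₁ ⧢ q₂`, then in a factorization `w = pq` of a shuffle of `a`
and `b` only those `q` count that are a suffix of `a` or of `b`. -/
lemma lsum_shuffle_splits_of_right [AddCommMonoid M] (a b : List α) (g : List α → List α → M)
    (hg : ∀ p q₁ q₂ : List α, (p ++ (q₁ ++ q₂)).Perm (a ++ b) →
      lsum (shuffle q₁ q₂) (fun q => g p q) =
        (if q₂ = [] then g p q₁ else 0) + if q₁ = [] then g p q₂ else 0) :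
    lsum (shuffle a b) (fun w => lsum (splits w) fun p => g p.1 p.2) =
      (lsum (splits a) fun p => lsum (shuffle p.1 b) fun u => g u p.2) +
        lsum (splits b) fun q => lsum (shuffle a q.1) fun u => g u q.2 := by
  rw [lsum_shuffle_splits]
  have key : ∀ p ∈ splits a, ∀ q ∈ splits b,
      (lsum (shuffle p.1 q.1) fun u => lsum (shuffle p.2 q.2) fun v => g u v) =
        (if q.2 = [] then lsum (shuffle p.1 q.1) fun u => g u p.2 else 0) +
          if p.2 = [] then lsum (shuffle p.1 q.1) fun u => g u q.2 else 0 := by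
    intro p hp q hq
    rw [lsum_congr fun u hu => hg u p.2 q.2 ?_, lsum_add]
    · split_ifs <;> simp
    · rw [← append_of_mem_splits hp, ← append_of_mem_splits hq]
      refine ((perm_of_mem_shuffle hu).append_right _).trans ?_
      simpa using (List.perm_append_comm_assoc q.1 p.2 q.2).append_left p.1
  rw [lsum_congr fun p hp => lsum_congr fun q hq => key p hp q hq]
  simp only [lsum_add]
  congr 1
  · exact lsum_congr fun p _ =>
      lsum_splits_ite_right b fun q _ => lsum (shuffle p.1 q) fun u => g u p.2
  · rw [lsum_comm]
    exact lsum_congr fun q _ =>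
      lsum_splits_ite_right a fun p _ => lsum (shuffle p q.1) fun u => g u q.2

/-- The mirror image of `lsum_shuffle_splits_of_right`. -/
lemma lsum_shuffle_splits_of_left [AddCommMonoid M] (a b : List α) (g : List α → List α → M)
    (hg : ∀ p q₁ q₂ : List α, (p ++ (q₁ ++ q₂)).Perm (a ++ b) →
      lsum (shuffle q₁ q₂) (fun q => g q p) =
        (if q₂ = [] then g q₁ p else 0) + if q₁ = [] then g q₂ p else 0) :
    lsum (shuffle a b) (fun w => lsum (splits w) fun p => g p.1 p.2) =
      (lsum (splits a) fun p => lsum (shuffle p.2 b) fun v => g p.1 v) +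
        lsum (splits b) fun q => lsum (shuffle a q.2) fun v => g q.1 v := by
  rw [lsum_shuffle_splits]
  have key : ∀ p ∈ splits a, ∀ q ∈ splits b,
      (lsum (shuffle p.1 q.1) fun u => lsum (shuffle p.2 q.2) fun v => g u v) =
        (if q.1 = [] then lsum (shuffle p.2 q.2) fun v => g p.1 v else 0) +
          if p.1 = [] then lsum (shuffle p.2 q.2) fun v => g q.1 v else 0 := by
    intro p hp q hq
    rw [lsum_comm, lsum_congr fun v hv => hg v p.1 q.1 ?_, lsum_add]
    · split_ifs <;> simp
    · rw [← append_of_mem_splits hp, ← append_of_mem_splits hq]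
      refine ((perm_of_mem_shuffle hv).append_right _).trans ?_
      refine List.perm_append_comm.trans ?_
      simpa using (List.perm_append_comm_assoc q.1 p.2 q.2).append_left p.1
  rw [lsum_congr fun p hp => lsum_congr fun q hq => key p hp q hq]
  simp only [lsum_add]
  congr 1
  · exact lsum_congr fun p _ =>
      lsum_splits_ite_left b fun _ q => lsum (shuffle p.2 q) fun v => g p.1 v
  · rw [lsum_comm]
    exact lsum_congr fun q _ =>
      lsum_splits_ite_left a fun _ p => lsum (shuffle p q.2) fun v => g q.1 v

variable [AddCommGroup M]

/-- The letter `x` is marked in `a`. On the left-hand side a word next to `x` is cut off from a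
shuffle of `a` and `b`; on the right-hand side it is cut off from `a` alone. The terms in which it
is cut off from `b` appear once from the left and once from the right of `x`, and cancel. -/
lemma lsum_pointedSplits_cut (a b : List α) (F : α → List α → List α → List α → M)
    (hF : ∀ (x : α) (p q₁ q₂ r : List α), (p ++ x :: r ++ (q₁ ++ q₂)).Perm (a ++ b) →
      lsum (shuffle q₁ q₂) (fun q => F x p q r) =
        (if q₂ = [] then F x p q₁ r else 0) + if q₁ = [] then F x p q₂ r else 0) :
    (lsum (pointedSplits a) fun t => lsum (splits b) fun s =>
        lsum (shuffle t.1 s.1) fun u => lsum (shuffle t.2.2 s.2) fun v =>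
          (lsum (splits u) fun k => F t.2.1 k.1 k.2 v) -
            lsum (splits v) fun k => F t.2.1 u k.1 k.2) =
      lsum (pointedSplits a) fun t =>
        (lsum (splits t.1) fun k => lsum (splits b) fun s =>
          lsum (shuffle k.1 s.1) fun u => lsum (shuffle t.2.2 s.2) fun v => F t.2.1 u k.2 v) -
        lsum (splits t.2.2) fun k => lsum (splits b) fun s =>
          lsum (shuffle t.1 s.1) fun u => lsum (shuffle k.2 s.2) fun v => F t.2.1 u k.1 v := by
  refine lsum_congr fun t ht => ?_
  obtain ⟨a₁, x, a₂⟩ := t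
  obtain rfl := append_of_mem_pointedSplits ht
  dsimp only
  have hL : ∀ s ∈ splits b,
      (lsum (shuffle a₁ s.1) fun u => lsum (shuffle a₂ s.2) fun v =>
          lsum (splits u) fun k => F x k.1 k.2 v) =
        (lsum (splits a₁) fun k => lsum (shuffle k.1 s.1) fun u =>
          lsum (shuffle a₂ s.2) fun v => F x u k.2 v) +
        lsum (splits s.1) fun k => lsum (shuffle a₁ k.1) fun u =>
          lsum (shuffle a₂ s.2) fun v => F x u k.2 v := by
    intro s hs
    rw [lsum_comm, lsum_congr fun v hv => lsum_shuffle_splits_of_right a₁ s.1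
      (fun u q => F x u q v) ?_, lsum_add]
    · congr 1 <;>
      · rw [lsum_comm]
        exact lsum_congr fun k _ => lsum_comm _ _ _
    · intro p q₁ q₂ hp
      refine hF x p q₁ q₂ v ?_
      rw [← append_of_mem_splits hs]
      have hv := perm_of_mem_shuffle hv
      rw [← Multiset.coe_eq_coe] at hp hv ⊢
      simp only [← Multiset.coe_add, ← Multiset.cons_coe, ← Multiset.singleton_add] at hp hv ⊢
      rw [hv]
      calc _ = (p + (q₁ + q₂) : Multiset α) + {x} + (a₂ + s.2) := by abel
        _ = _ := by rw [hp]; abel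
  have hR : ∀ s ∈ splits b,
      (lsum (shuffle a₁ s.1) fun u => lsum (shuffle a₂ s.2) fun v =>
          lsum (splits v) fun k => F x u k.1 k.2) =
        (lsum (splits a₂) fun k => lsum (shuffle a₁ s.1) fun u =>
          lsum (shuffle k.2 s.2) fun v => F x u k.1 v) +
        lsum (splits s.2) fun k => lsum (shuffle a₁ s.1) fun u =>
          lsum (shuffle a₂ k.2) fun v => F x u k.1 v := by
    intro s hs
    rw [lsum_congr fun u hu => lsum_shuffle_splits_of_left a₂ s.2
      (fun q v => F x u q v) ?_, lsum_add]
    · congr 1 <;> exact lsum_comm _ _ _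
    · intro r q₁ q₂ hr
      refine hF x u q₁ q₂ r ?_
      rw [← append_of_mem_splits hs]
      have hu := perm_of_mem_shuffle hu
      rw [← Multiset.coe_eq_coe] at hr hu ⊢
      simp only [← Multiset.coe_add, ← Multiset.cons_coe, ← Multiset.singleton_add] at hr hu ⊢
      rw [hu]
      calc _ = (r + (q₁ + q₂) : Multiset α) + {x} + (a₁ + s.1) := by abel
        _ = _ := by rw [hr]; abel
  simp only [lsum_sub]
  rw [lsum_congr hL, lsum_congr hR, lsum_add, lsum_add, lsum_comm (splits a₁),
    lsum_comm (splits a₂),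
    lsum_splits_assoc b fun b₁ b₂ b₃ => lsum (shuffle a₁ b₁) fun u =>
      lsum (shuffle a₂ b₃) fun v => F x u b₂ v]
  abel

/-- The version of `lsum_pointedSplits_cut` for a letter marked anywhere in the shuffle. -/
lemma lsum_shuffle_cut (a b : List α) (F : α → List α → List α → List α → M)
    (hF : ∀ (x : α) (p q₁ q₂ r : List α), (p ++ x :: r ++ (q₁ ++ q₂)).Perm (a ++ b) →
      lsum (shuffle q₁ q₂) (fun q => F x p q r) =
        (if q₂ = [] then F x p q₁ r else 0) + if q₁ = [] then F x p q₂ r else 0) :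
    (lsum (shuffle a b) fun w => lsum (pointedSplits w) fun t =>
        (lsum (splits t.1) fun k => F t.2.1 k.1 k.2 t.2.2) -
          lsum (splits t.2.2) fun k => F t.2.1 t.1 k.1 k.2) =
      (lsum (pointedSplits a) fun t =>
        (lsum (splits t.1) fun k => lsum (splits b) fun s =>
          lsum (shuffle k.1 s.1) fun u => lsum (shuffle t.2.2 s.2) fun v => F t.2.1 u k.2 v) -
        lsum (splits t.2.2) fun k => lsum (splits b) fun s =>
          lsum (shuffle t.1 s.1) fun u => lsum (shuffle k.2 s.2) fun v => F t.2.1 u k.1 v) +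
      lsum (pointedSplits b) fun t =>
        (lsum (splits t.1) fun k => lsum (splits a) fun s =>
          lsum (shuffle k.1 s.1) fun u => lsum (shuffle t.2.2 s.2) fun v => F t.2.1 u k.2 v) -
        lsum (splits t.2.2) fun k => lsum (splits a) fun s =>
          lsum (shuffle t.1 s.1) fun u => lsum (shuffle k.2 s.2) fun v => F t.2.1 u k.1 v := by
  rw [lsum_shuffle_pointedSplits a b fun u x v =>
    (lsum (splits u) fun k => F x k.1 k.2 v) - lsum (splits v) fun k => F x u k.1 k.2,
    lsum_pointedSplits_cut a b F hF, lsum_pointedSplits_cut b a F fun x p q₁ q₂ r h =>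
      hF x p q₁ q₂ r (h.trans List.perm_append_comm)]

end Combinatorics

variable {U V : Type*} [AddCommGroup U] [AddCommGroup V]

/-! ### Flexions and decks -/

section Flexions

lemma upperSum_eq_of_perm {U V : Type*} [AddCommGroup U] {w w' : Word U V} (h : w.Perm w') :
    upperSum w = upperSum w' :=
  (h.map _).sum_eq

lemma fur_append_singleton {U V : Type*} [AddCommGroup U] (a : Word U V) (x : U × V)
    (b : Word U V) :
    fur (a ++ [x]) b = a ++ [(x.1 + upperSum b, x.2)] := by
  induction a with
  | nil => rfl
  | cons y a ih => cases a <;> simp_all [fur]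

lemma fll_append_singleton {U V : Type*} [AddCommGroup V] (a : Word U V) (x : U × V)
    (b : Word U V) :
    fll (a ++ [x]) b = lowerShift x.2 b := by
  simp [fll]

end Flexions

namespace Deck

variable {𝒳 : Deck U V}

lemma left_mem_of_perm {a b w : Word U V} (hw : w ∈ 𝒳.words) (h : w.Perm (a ++ b)) :
    a ∈ 𝒳.words :=
  𝒳.factor_mem (𝒳.perm_mem h hw)

lemma lowerShift_mem {x : U × V} {b w : Word U V} (hw : w ∈ 𝒳.words)
    (h : w.Perm (b ++ [x])) : lowerShift x.2 b ∈ 𝒳.words :=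
  𝒳.flr_mem (𝒳.perm_mem h hw)

lemma raise_mem {x : U × V} {q r w : Word U V} (hw : w ∈ 𝒳.words)
    (h : w.Perm (r ++ q ++ [x])) : r ++ [(upperSum q + x.1, x.2)] ∈ 𝒳.words :=
  𝒳.ful_mem (𝒳.perm_mem h hw)

end Deck

/-! ### Bimoulds -/

namespace Bimould

variable {𝒳 : Deck U V} {R : Type*} [CommRing R]

lemma eval_of_mem (A : Bimould 𝒳 R) (w : 𝒳.words) : A.eval w.1 = A w := by
  simp [eval]

lemma evalShuffle_eq_lsum (A : Bimould 𝒳 R) (a b : Word U V) :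
    A.evalShuffle a b = lsum (shuffle a b) A.eval := rfl

/-- The value of `S` at `p x r` after the word `q` next to the letter `x` has been absorbed into
`x`, times the value of `D` at the word `q` that was removed. It is the common shape of the summands of
`amit` (for `w = p q x r`) and of `anit` (for `w = p x q r`). -/
noncomputable def absorb (S D : Bimould 𝒳 R) (x : U × V) (p q r : Word U V) : R :=
  S.eval (p ++ (upperSum q + x.1, x.2) :: r) * D.eval (lowerShift x.2 q)

/-- `arit(D)(S)(w)` as a sum over the letters of `w` that absorb a word on their left or right.
The absorbed word may be empty, since `D(∅) = 0`. -/
noncomputable def aritSum (S D : Bimould 𝒳 R) (w : Word U V) : R :=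
  lsum (pointedSplits w) fun t =>
    (lsum (splits t.1) fun k => S.absorb D t.2.1 k.1 k.2 t.2.2) -
      lsum (splits t.2.2) fun k => S.absorb D t.2.1 t.1 k.1 k.2

/-- `mu(S, D)` as a function of all words. -/
noncomputable def muSum (S D : Bimould 𝒳 R) (w : Word U V) : R :=
  lsum (splits w) fun p => S.eval p.1 * D.eval p.2

lemma amit_apply {S D : Bimould 𝒳 R} (hD : D.eval [] = 0) (w : 𝒳.words) :
    amit D S w = lsum (pointedSplits w.1) fun t =>
      lsum (splits t.1) fun k => S.absorb D t.2.1 k.1 k.2 t.2.2 := by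
  change lsum (List.filter _ (splits₃ w.1)) _ = _
  rw [lsum_filter, splits₃, lsum_flatMap, ← lsum_splits_pointedSplits w.1
    fun p q x r => S.absorb D x p q r]
  refine lsum_congr fun p _ => ?_
  rw [lsum_map, lsum_splits_eq_add_right p.2 fun b c =>
    if !b.isEmpty && !c.isEmpty then S.eval (p.1 ++ ful b c) * D.eval (flr b c) else 0]
  simp only [List.isEmpty_nil, Bool.not_true, Bool.and_false, Bool.false_eq_true, if_false,
    zero_add]
  refine lsum_congr fun q _ => ?_
  cases hq : q.1 with
  | nil => simp [absorb, lowerShift, hD]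
  | cons y q => simp [absorb, ful, flr]

lemma anit_apply {S D : Bimould 𝒳 R} (hD : D.eval [] = 0) (w : 𝒳.words) :
    anit D S w = lsum (pointedSplits w.1) fun t =>
      lsum (splits t.2.2) fun k => S.absorb D t.2.1 t.1 k.1 k.2 := by
  change lsum (List.filter _ (splits₃ w.1)) _ = _
  rw [lsum_filter, splits₃, lsum_flatMap]
  simp only [lsum_map]
  rw [lsum_splits_eq_add_left w.1 fun p v => lsum (splits v) fun k =>
    if !p.isEmpty && !k.1.isEmpty then S.eval (fur p k.1 ++ k.2) * D.eval (fll p k.1) else 0]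
  simp only [List.isEmpty_nil, Bool.not_true, Bool.false_and, Bool.false_eq_true, if_false,
    lsum_zero, zero_add]
  refine lsum_congr fun t _ => lsum_congr fun k _ => ?_
  rw [fur_append_singleton, fll_append_singleton]
  cases hk : k.1 with
  | nil => simp [absorb, lowerShift, hD]
  | cons y q => simp [absorb, add_comm]

lemma preari_apply {S D : Bimould 𝒳 R} (hD : D.eval [] = 0) (w : 𝒳.words) :
    S.preari D w = S.aritSum D w.1 + S.muSum D w.1 := by
  change amit D S w - anit D S w + S.muSum D w.1 = _
  rw [amit_apply hD, anit_apply hD, ← lsum_sub, aritSum]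

/-- A bimould with `D(∅) = 0` that vanishes at all non-trivial shuffles only sees the trivial terms
of a shuffle. -/
lemma evalShuffle_eq_ite {D : Bimould 𝒳 R} (hD : D.eval [] = 0) {a b : Word U V}
    (h : a ≠ [] → b ≠ [] → D.evalShuffle a b = 0) :
    D.evalShuffle a b = (if b = [] then D.eval a else 0) + if a = [] then D.eval b else 0 := by
  by_cases ha : a = []
  · subst ha
    by_cases hb : b = [] <;> simp [hb, hD, evalShuffle]
  · by_cases hb : b = []
    · simp [ha, hb, evalShuffle]
    · simp [ha, hb, h ha hb]

/-! ### The action of `preari` on shuffles -/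

/-- The hypothesis, on words shorter than `n`, that `S` is symmetral and `D` is alternal. -/
structure IsShufflePairBelow (S D : Bimould 𝒳 R) (n : ℕ) : Prop where
  left_nil : S.eval [] = 1
  right_nil : D.eval [] = 0
  symmetral : ∀ a b : Word U V, a ≠ [] → b ≠ [] → a ++ b ∈ 𝒳.words → (a ++ b).length < n →
    S.evalShuffle a b = S.eval a * S.eval b
  alternal : ∀ a b : Word U V, a ≠ [] → b ≠ [] → a ++ b ∈ 𝒳.words → (a ++ b).length < n →
    D.evalShuffle a b = 0

namespace IsShufflePairBelow

variable {S D : Bimould 𝒳 R} {a b : Word U V}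

lemma evalShuffle_left {n : ℕ} (H : IsShufflePairBelow S D n) (hab : a ++ b ∈ 𝒳.words)
    (hn : (a ++ b).length < n) : S.evalShuffle a b = S.eval a * S.eval b := by
  by_cases ha : a = []
  · simp [ha, evalShuffle, H.left_nil]
  by_cases hb : b = []
  · simp [hb, evalShuffle, H.left_nil]
  exact H.symmetral a b ha hb hab hn

lemma absorb_shuffle (H : IsShufflePairBelow S D (a ++ b).length) (hab : a ++ b ∈ 𝒳.words)
    (x : U × V) (p q₁ q₂ r : Word U V) (h : (p ++ x :: r ++ (q₁ ++ q₂)).Perm (a ++ b)) :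
    lsum (shuffle q₁ q₂) (fun q => S.absorb D x p q r) =
      (if q₂ = [] then S.absorb D x p q₁ r else 0) +
        if q₁ = [] then S.absorb D x p q₂ r else 0 := by
  -- The words `q ∈ q₁ ⧢ q₂` have the same upper sum, so that `S` contributes a constant factor.
  have hc : ∀ q ∈ shuffle q₁ q₂, S.absorb D x p q r = D.eval (lowerShift x.2 q) *
      S.eval (p ++ (upperSum (q₁ ++ q₂) + x.1, x.2) :: r) := fun q hq => by
    rw [absorb, upperSum_eq_of_perm (perm_of_mem_shuffle hq), mul_comm]
  have hs : (lsum (shuffle q₁ q₂) fun q => D.eval (lowerShift x.2 q)) =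
      D.evalShuffle (lowerShift x.2 q₁) (lowerShift x.2 q₂) := by
    rw [evalShuffle_eq_lsum, lowerShift, lowerShift, shuffle_map, lsum_map]
    rfl
  have hlen := h.length_eq
  rw [lsum_congr hc, lsum_mul, hs, evalShuffle_eq_ite H.right_nil fun h₁ h₂ =>
    H.alternal _ _ h₁ h₂ ?_ ?_]
  · by_cases h₁ : q₁ = [] <;> by_cases h₂ : q₂ = [] <;>
      simp [h₁, h₂, absorb, lowerShift, H.right_nil, mul_comm]
  · have := 𝒳.lowerShift_mem (x := x) (b := q₁ ++ q₂) (w := q₁ ++ q₂ ++ [x])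
      (𝒳.left_mem_of_perm hab (b := p ++ r) (h.symm.trans ?_)) (List.Perm.refl _)
    · simpa [lowerShift] using this
    · rw [← Multiset.coe_eq_coe]
      simp only [← Multiset.coe_add, ← Multiset.cons_coe, ← Multiset.singleton_add,
        Multiset.coe_nil, add_zero]
      abel
  · simp [lowerShift] at hlen ⊢
    omega

/-- If the letter `x` of `a` absorbs a word `q` that is itself part of `a`, then shuffling the
remaining word with `b` multiplies the contribution by `S(b)`, because `S` is symmetral. -/
lemma lsum_absorb (H : IsShufflePairBelow S D (a ++ b).length) (hab : a ++ b ∈ 𝒳.words)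
    {x : U × V} {p q r : Word U V} (h : a.Perm (p ++ x :: r ++ q)) :
    (lsum (splits b) fun s => lsum (shuffle p s.1) fun u => lsum (shuffle r s.2) fun v =>
      S.absorb D x u q v) = S.absorb D x p q r * S.eval b := by
  by_cases hq : q = []
  · simp [hq, absorb, lowerShift, H.right_nil]
  simp only [absorb, lsum_mul]
  rw [← lsum_shuffle_append_cons p (upperSum q + x.1, x.2) r b fun w => S.eval w,
    ← evalShuffle_eq_lsum, H.evalShuffle_left, mul_right_comm]
  · refine 𝒳.perm_mem ?_ (𝒳.raise_mem (q := q) (r := p ++ r ++ b) (x := x) hab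
      ((h.append_right b).trans ?_)) <;>
    · rw [← Multiset.coe_eq_coe]
      simp only [← Multiset.coe_add, ← Multiset.cons_coe, ← Multiset.singleton_add,
        Multiset.coe_nil, add_zero]
      abel
  · have := h.length_eq
    have := List.length_pos_iff.2 hq
    simp at *
    omega

/-- `arit(D)` acts on `S` as a derivation with respect to shuffles. -/
lemma lsum_aritSum (H : IsShufflePairBelow S D (a ++ b).length) (hab : a ++ b ∈ 𝒳.words) :
    lsum (shuffle a b) (S.aritSum D) =
      S.aritSum D a * S.eval b + S.aritSum D b * S.eval a := by
  have half : ∀ {a b : Word U V}, IsShufflePairBelow S D (a ++ b).length → a ++ b ∈ 𝒳.words →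
      (lsum (pointedSplits a) fun t =>
        (lsum (splits t.1) fun k => lsum (splits b) fun s => lsum (shuffle k.1 s.1) fun u =>
          lsum (shuffle t.2.2 s.2) fun v => S.absorb D t.2.1 u k.2 v) -
        lsum (splits t.2.2) fun k => lsum (splits b) fun s => lsum (shuffle t.1 s.1) fun u =>
          lsum (shuffle k.2 s.2) fun v => S.absorb D t.2.1 u k.1 v) =
      S.aritSum D a * S.eval b := by
    intro a b H hab
    rw [aritSum, ← lsum_mul]
    refine lsum_congr fun t ht => ?_
    rw [sub_mul, ← lsum_mul, ← lsum_mul]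
    congr 1 <;> refine lsum_congr fun k hk => H.lsum_absorb hab ?_ <;>
    · rw [← append_of_mem_pointedSplits ht]
      nth_rw 1 [← append_of_mem_splits hk]
      rw [← Multiset.coe_eq_coe]
      simp only [← Multiset.coe_add, ← Multiset.cons_coe, ← Multiset.singleton_add]
      abel
  have hcomm : (b ++ a).length = (a ++ b).length := List.perm_append_comm.length_eq
  rw [← half H hab, ← half (hcomm ▸ H) (𝒳.perm_mem List.perm_append_comm hab)]
  exact lsum_shuffle_cut a b _ (H.absorb_shuffle hab)

/-- `mu(S, D)` obeys the same rule, up to the one term `D(a ⧢ b)` in which `D` takes a word of full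
length. -/
lemma lsum_muSum (H : IsShufflePairBelow S D (a ++ b).length) (ha : a ≠ []) (hb : b ≠ [])
    (hab : a ++ b ∈ 𝒳.words) :
    lsum (shuffle a b) (S.muSum D) =
      D.evalShuffle a b + (S.muSum D a * S.eval b + S.muSum D b * S.eval a) := by
  -- `g` omits the term `S(∅) D(w)` of `mu(S, D)(w)`.
  let g : Word U V → Word U V → R := fun p q => if p = [] then 0 else S.eval p * D.eval q
  have hg : ∀ w : Word U V, w ≠ [] →
      S.muSum D w = D.eval w + lsum (splits w) fun p => g p.1 p.2 := by
    intro w hw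
    rw [muSum, lsum_splits_eq_add_left w fun p q => S.eval p * D.eval q,
      lsum_splits_eq_add_left w g]
    simp [g, H.left_nil]
  have hne : ∀ {w p q : Word U V}, w ∈ shuffle p q → p ≠ [] ∨ q ≠ [] → w ≠ [] := by
    rintro w p q hw h rfl
    have := (perm_of_mem_shuffle hw).length_eq
    have hpq : p.length = 0 ∧ q.length = 0 := by simp at this; omega
    simp_all
  have half : ∀ {a b : Word U V}, b ≠ [] → IsShufflePairBelow S D (a ++ b).length →
      a ++ b ∈ 𝒳.words →
      (lsum (splits a) fun p => lsum (shuffle p.1 b) fun u => g u p.2) =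
        S.muSum D a * S.eval b := by
    intro a b hb H hab
    rw [muSum, ← lsum_mul]
    refine lsum_congr fun p hp => ?_
    rw [lsum_congr fun u hu => if_neg (hne hu (Or.inr hb)), lsum_mul, ← evalShuffle_eq_lsum]
    by_cases hp2 : p.2 = []
    · simp [hp2, H.right_nil]
    have hp' := append_of_mem_splits hp
    rw [H.evalShuffle_left, mul_right_comm]
    · refine 𝒳.left_mem_of_perm hab (b := p.2) ?_
      rw [← hp']
      simpa using (List.perm_append_comm (l₁ := p.2) (l₂ := b)).append_left p.1
    · have := List.length_pos_iff.2 hp2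
      rw [← hp']
      simp
      omega
  have hcut := lsum_shuffle_splits_of_right a b g fun p q₁ q₂ hp => by
    by_cases hp0 : p = []
    · simp [g, hp0]
    have hlen := hp.length_eq
    have := List.length_pos_iff.2 hp0
    have hd := evalShuffle_eq_ite H.right_nil fun h₁ h₂ => H.alternal q₁ q₂ h₁ h₂
      (𝒳.left_mem_of_perm hab (hp.symm.trans List.perm_append_comm))
      (by simp at *; omega)
    rw [evalShuffle_eq_lsum] at hd
    simp only [g, hp0, if_false, mul_comm (S.eval p), lsum_mul]
    rw [show lsum (shuffle q₁ q₂) (fun q => D.eval q) = _ from hd, add_mul, ite_mul, ite_mul,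
      zero_mul]
  have hcomm : (b ++ a).length = (a ++ b).length := List.perm_append_comm.length_eq
  rw [lsum_congr fun w hw => hg w (hne hw (Or.inl ha)), lsum_add, hcut, half hb H hab,
    ← half ha (hcomm ▸ H) (𝒳.perm_mem List.perm_append_comm hab)]
  congr 2
  exact lsum_congr fun q _ => lsum_perm (shuffle_comm _ _) _

end IsShufflePairBelow

/-- The key identity: if `S` is symmetral and `D` alternal on words shorter than `ab`, then the
failure of `S` to be symmetral at `(a, b)` is, up to the factor `ℓ(ab)`, the failure of `D` to be
alternal there. -/
lemma length_mul_evalShuffle_sub {S D : Bimould 𝒳 R} (h : S.der = S.preari D) {a b : Word U V}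
    (H : IsShufflePairBelow S D (a ++ b).length) (ha : a ≠ []) (hb : b ≠ [])
    (hab : a ++ b ∈ 𝒳.words) :
    ((a ++ b).length : R) * (S.evalShuffle a b - S.eval a * S.eval b) = D.evalShuffle a b := by
  have hder : ∀ w ∈ 𝒳.words, (w.length : R) * S.eval w = S.aritSum D w + S.muSum D w := by
    intro w hw
    rw [← preari_apply H.right_nil ⟨w, hw⟩, ← h, S.eval_of_mem ⟨w, hw⟩]
    rfl
  have hsum : ((a ++ b).length : R) * S.evalShuffle a b =
      lsum (shuffle a b) (S.aritSum D) + lsum (shuffle a b) (S.muSum D) := by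
    rw [evalShuffle_eq_lsum, mul_comm, ← lsum_mul, ← lsum_add]
    refine lsum_congr fun w hw => ?_
    have hp := perm_of_mem_shuffle hw
    rw [← hder w (𝒳.perm_mem hp.symm hab), hp.length_eq, mul_comm]
  have ha' := hder a (𝒳.factor_mem hab)
  have hb' := hder b (𝒳.left_mem_of_perm hab List.perm_append_comm)
  rw [mul_sub, hsum, H.lsum_aritSum hab, H.lsum_muSum ha hb hab, List.length_append, Nat.cast_add]
  linear_combination (-S.eval b) * ha' + (-S.eval a) * hb'

end Bimould

end Mould

theorem mainTheorem11 {U V R : Type*} [AddCommGroup U] [AddCommGroup V]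
    [CommRing R] [Algebra ℚ R] (𝒳 : Mould.Deck U V) (S D : Mould.Bimould 𝒳 R)
    (hS : S ∈ Mould.Bimould.MU 𝒳 R) (hD : D ∈ Mould.Bimould.LU 𝒳 R)
    (h : S.der = S.preari D) :
    D.IsAlternal ↔ S.IsSymmetral := by
  constructor
  · rintro ⟨-, hA⟩
    have main : ∀ n, Mould.Bimould.IsShufflePairBelow S D n := by
      intro n
      induction n with
      | zero => exact ⟨hS, hD, by simp, by simp⟩
      | succ n ih =>
        refine ⟨hS, hD, fun a b ha hb hab hn => ?_, fun a b ha hb hab _ => hA a b ha hb hab⟩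
        rcases Nat.lt_succ_iff_lt_or_eq.1 hn with hn | rfl
        · exact ih.symmetral a b ha hb hab hn
        have key := Mould.Bimould.length_mul_evalShuffle_sub h ih ha hb hab
        rw [hA a b ha hb hab] at key
        -- The length is invertible in a `ℚ`-algebra.
        have hu : IsUnit (((a ++ b).length : ℕ) : R) := by
          rw [← map_natCast (algebraMap ℚ R)]
          refine IsUnit.map _ (IsUnit.mk0 _ ?_)
          exact Nat.cast_ne_zero.2 (by simp [ha])
        exact sub_eq_zero.1 (hu.mul_right_eq_zero.1 key)
    exact ⟨hS, fun a b ha hb hab => (main _).symmetral a b ha hb hab (Nat.lt_succ_self _)⟩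
  · rintro ⟨-, hA⟩
    have main : ∀ n, Mould.Bimould.IsShufflePairBelow S D n := by
      intro n
      induction n with
      | zero => exact ⟨hS, hD, by simp, by simp⟩
      | succ n ih =>
        refine ⟨hS, hD, fun a b ha hb hab _ => hA a b ha hb hab, fun a b ha hb hab hn => ?_⟩
        rcases Nat.lt_succ_iff_lt_or_eq.1 hn with hn | rfl
        · exact ih.alternal a b ha hb hab hn
        rw [← Mould.Bimould.length_mul_evalShuffle_sub h ih ha hb hab, hA a b ha hb hab, sub_self,
          mul_zero]
    exact ⟨hD, fun a b ha hb hab => (main _).alternal a b ha hb hab (Nat.lt_succ_self _)⟩
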